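/- Let $(M^2,g)$ be a smooth Riemannian surface with Gaussian curvature $K$, let $c\in\mathbb{R}$ be a constant, and suppose that $c-K>0$ at every point of $M$. Let $\Delta=-\operatorname{div}\operatorname{grad}$ be the Laplace--Beltrami operator of $g$ (with the sign that makes it nonnegative), and let $\nabla K$ be the gradient of $K$ with respect to $g$. Then the following conditions are equivalent: (i) $(c-K)\,\Delta K-|\nabla K|^2-\tfrac{8}{3}K(c-K)^2=0$ on $M$; (ii) $\Delta\log(c-K)+\tfrac{8}{3}K=0$ on $M$; (iii) $(c-K)^{3/4}g$ is a flat Riemannian metric on $M$. Moreover, if $c=0$, then each of these conditions is also equivalent to (iv) $(-K)g$ is a Riemannian metric on $M$ of constant Gaussian curvature $1/3$. -/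

import Mathlib

open scoped Manifold ContDiff

noncomputable section

namespace RiemSurface

/-- The coordinate plane `ℝ²`. -/
abbrev Plane : Type := EuclideanSpace ℝ (Fin 2)

/-- Smooth Riemannian metrics on a smooth surface `M`. -/
abbrev Metric (M : Type*) [TopologicalSpace M] [ChartedSpace Plane M]
    [IsManifold (𝓡 2) ∞ M] : Type _ :=
  Bundle.ContMDiffRiemannianMetric (𝓡 2) ∞ Plane (fun x : M => TangentSpace (𝓡 2) x)

/-- The partial derivative `∂ᵢ f` at `y`. -/
def pd (i : Fin 2) (f : Plane → ℝ) (y : Plane) : ℝ :=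
  fderiv ℝ f y (EuclideanSpace.single i 1)

/-- The Christoffel symbol `Γᵏᵢⱼ = ½ ∑ₗ gᵏˡ (∂ᵢ gⱼₗ + ∂ⱼ gᵢₗ - ∂ₗ gᵢⱼ)` of a metric with
coordinate expression `G = (gᵢⱼ)`. -/
def christoffel (G : Plane → Matrix (Fin 2) (Fin 2) ℝ) (k i j : Fin 2) (y : Plane) : ℝ :=
  (1 / 2) * ∑ l, (G y)⁻¹ k l *
    (pd i (fun z => G z j l) y + pd j (fun z => G z i l) y - pd l (fun z => G z i j) y)

/-- The component `Rˡₖᵢⱼ` of the curvature tensor `R(X,Y)Z = ∇_X ∇_Y Z - ∇_Y ∇_X Z - ∇_[X,Y] Z`,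
that is, `R(∂ᵢ, ∂ⱼ) ∂ₖ = ∑ₗ Rˡₖᵢⱼ ∂ₗ`. -/
def riemann (G : Plane → Matrix (Fin 2) (Fin 2) ℝ) (l k i j : Fin 2) (y : Plane) : ℝ :=
  pd i (christoffel G l j k) y - pd j (christoffel G l i k) y
    + ∑ m, (christoffel G m j k y * christoffel G l i m y
        - christoffel G m i k y * christoffel G l j m y)

/-- The Gaussian curvature `⟨R(∂₁, ∂₂) ∂₂, ∂₁⟩ / det (gᵢⱼ)` of a metric with coordinate
expression `G = (gᵢⱼ)` (the two coordinates carry the indices `0` and `1` here). -/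
def coordGauss (G : Plane → Matrix (Fin 2) (Fin 2) ℝ) (y : Plane) : ℝ :=
  (∑ l, G y 0 l * riemann G l 1 0 1 y) / (G y).det

/-- The Laplacian `-∑ᵢⱼ gⁱʲ (∂ᵢ ∂ⱼ f - ∑ₖ Γᵏᵢⱼ ∂ₖ f)`, with the sign for which it is
nonnegative, of a function on the coordinate plane. -/
def coordLaplacian (G : Plane → Matrix (Fin 2) (Fin 2) ℝ) (f : Plane → ℝ) (y : Plane) : ℝ :=
  -∑ i, ∑ j, (G y)⁻¹ i j * (pd i (pd j f) y - ∑ k, christoffel G k i j y * pd k f y)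

/-- The squared norm `|∇f|² = ∑ᵢⱼ gⁱʲ ∂ᵢ f ∂ⱼ f` of the gradient of a function on the
coordinate plane. -/
def coordGradNormSq (G : Plane → Matrix (Fin 2) (Fin 2) ℝ) (f : Plane → ℝ) (y : Plane) : ℝ :=
  ∑ i, ∑ j, (G y)⁻¹ i j * pd i f y * pd j f y

variable {M : Type*} [TopologicalSpace M] [ChartedSpace Plane M] [IsManifold (𝓡 2) ∞ M]

/-- The coordinate vector field `∂ᵢ` of the chart `e`, at the point with coordinates `y`. -/
def coordVector (e : OpenPartialHomeomorph M Plane) (i : Fin 2) (y : Plane) :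
    TangentSpace (𝓡 2) (e.symm y) :=
  mfderiv (𝓡 2) (𝓡 2) e.symm y (EuclideanSpace.single i (1 : ℝ) : Plane)

/-- The coordinate expression `gᵢⱼ = g(∂ᵢ, ∂ⱼ)` of the metric `g` in the chart `e`. -/
def metricMatrix (g : Metric M) (e : OpenPartialHomeomorph M Plane) (y : Plane) :
    Matrix (Fin 2) (Fin 2) ℝ :=
  Matrix.of fun i j => g.inner (e.symm y) (coordVector e i y) (coordVector e j y)

/-- The Gaussian curvature of `g` at `p`, computed in the preferred chart at `p` (its value does
not depend on the chart, and likewise for the two operators below). -/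
def gaussCurvature (g : Metric M) (p : M) : ℝ :=
  coordGauss (metricMatrix g (chartAt Plane p)) (chartAt Plane p p)

/-- The Laplace-Beltrami operator `Δ = -div grad = -trace (∇∇ - ∇_∇)` of `g` on functions. -/
def laplacian (g : Metric M) (f : M → ℝ) (p : M) : ℝ :=
  coordLaplacian (metricMatrix g (chartAt Plane p)) (f ∘ (chartAt Plane p).symm)
    (chartAt Plane p p)

/-- The squared length `|∇f|²` of the gradient of `f` with respect to `g`. -/
def gradNormSq (g : Metric M) (f : M → ℝ) (p : M) : ℝ :=
  coordGradNormSq (metricMatrix g (chartAt Plane p)) (f ∘ (chartAt Plane p).symm)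
    (chartAt Plane p p)

/-- The metric `g` has constant Gaussian curvature `k`. -/
def HasConstantCurvature (g : Metric M) (k : ℝ) : Prop :=
  ∀ p : M, gaussCurvature g p = k

/-- The metric `g` is flat. -/
def IsFlat (g : Metric M) : Prop :=
  HasConstantCurvature g 0

/-- The metric `h` is the metric `u g`. -/
def IsScaling (h g : Metric M) (u : M → ℝ) : Prop :=
  ∀ (p : M) (v w : TangentSpace (𝓡 2) p), h.inner p v w = u p * g.inner p v w

end RiemSurface

end

open scoped Manifold ContDiff

noncomputable section

namespace RiemSurface

/-! ### Smoothness and nondegeneracy of the metric in a chart -/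

section ManifoldSide

variable {M : Type*} [TopologicalSpace M] [ChartedSpace Plane M] [IsManifold (𝓡 2) ∞ M]
open Bundle Topology Filter

/-! Everything rests on the conformal change formula in dimension two: with `Δ = -div grad`, the
metric `u g` has curvature `(K + ½ Δ log u) / u` (`coordGauss_smul`, `gaussCurvature_of_isScaling`).
For `u = (c - K)^(3/4)`, flatness reads `K + (3/8) Δ log (c - K) = 0`, which is (ii). For `c = 0`
and `u = -K`, curvature `1/3` reads `K + ½ Δ log (-K) = -K/3`, again (ii). Finally `Δ log (c - K) =
-ΔK/(c - K) + |∇K|²/(c - K)²`, so (i) is (ii) multiplied by `-(c - K)²`.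

These computations, and the existence of `u g` as a smooth metric, require `K` to be smooth. Since
`K` is defined pointwise through a preferred chart that varies with the point, this needs its
invariance under coordinate change (`coordGauss_pullback`). Both this invariance and the conformal
formula come from one device: the Levi-Civita connection is treated as a pair of matrices
characterised by symmetry and metric compatibility (`conn_unique`). A candidate for the new
connection is written down and recognised by uniqueness, and its curvature is then computed by
matrix calculus. -/

theorem contMDiffAt_coordVector {e : OpenPartialHomeomorph M Plane} (he : e ∈ atlas Plane M)
    {y : Plane} (hy : y ∈ e.target) (i : Fin 2) :
    ContMDiffAt (𝓡 2) (𝓡 2).tangent ∞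
      (fun z => (TotalSpace.mk' Plane (e.symm z) (coordVector e i z) :
        TangentBundle (𝓡 2) M)) y := by
  have h1 : ContMDiffOn (𝓡 2) (𝓡 2) ∞ e.symm e.target :=
    contMDiffOn_symm_of_mem_maximalAtlas (IsManifold.subset_maximalAtlas he)
  have h2 := h1.contMDiffOn_tangentMapWithin (m := ∞) (by simp) e.open_target.uniqueMDiffOn
  have h3 : ContMDiffAt (𝓡 2) (𝓡 2).tangent ∞
      (fun z : Plane => (TotalSpace.mk' Plane z (EuclideanSpace.single i (1 : ℝ) : Plane) :
        TangentBundle (𝓡 2) Plane)) y :=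
    contMDiffAt_vectorSpace_iff_contDiffAt.2 contDiffAt_const
  -- The field `∂ᵢ` is the tangent map of `e.symm` applied to a constant section, so it inherits the
  -- smoothness of that tangent map.
  have h4 : ContMDiffAt (𝓡 2).tangent (𝓡 2).tangent ∞
      (tangentMapWithin (𝓡 2) (𝓡 2) e.symm e.target)
      (TotalSpace.mk' Plane y (EuclideanSpace.single i (1 : ℝ) : Plane) :
        TangentBundle (𝓡 2) Plane) := by
    refine h2.contMDiffAt ?_
    exact (FiberBundle.continuous_proj Plane _).continuousAt.preimage_mem_nhds
      (e.open_target.mem_nhds hy)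
  refine (h4.comp y h3).congr_of_eventuallyEq ?_
  filter_upwards [e.open_target.mem_nhds hy] with z hz
  simp only [Function.comp, tangentMapWithin, coordVector,
    mfderivWithin_of_isOpen e.open_target hz]

theorem contDiffAt_metricMatrix (g : Metric M) {e : OpenPartialHomeomorph M Plane}
    (he : e ∈ atlas Plane M) {y : Plane} (hy : y ∈ e.target) (i j : Fin 2) :
    ContDiffAt ℝ ∞ (fun z => metricMatrix g e z i j) y := by
  let _ : RiemannianBundle (fun x : M => TangentSpace (𝓡 2) x) := ⟨g.toRiemannianMetric⟩
  have := (contMDiffAt_coordVector he hy i).inner_bundle (contMDiffAt_coordVector he hy j)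
  exact this.contDiffAt

theorem metricMatrix_symm (g : Metric M) (e : OpenPartialHomeomorph M Plane) (y : Plane)
    (i j : Fin 2) : metricMatrix g e y i j = metricMatrix g e y j i :=
  g.symm _ _ _

theorem metricMatrix_det_ne_zero (g : Metric M) {e : OpenPartialHomeomorph M Plane}
    (he : e ∈ atlas Plane M) {y : Plane} (hy : y ∈ e.target) :
    (metricMatrix g e y).det ≠ 0 := by
  have hinj : Function.Injective (mfderiv (𝓡 2) (𝓡 2) e.symm y) :=
    (mdifferentiable_of_mem_atlas (I := 𝓡 2) he).symm.mfderiv_injective hy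
  have key : ∀ a b : ℝ, (a ≠ 0 ∨ b ≠ 0) → 0 < a * a * metricMatrix g e y 0 0
      + 2 * (a * b) * metricMatrix g e y 0 1 + b * b * metricMatrix g e y 1 1 := by
    intro a b hab
    have hv : a • coordVector e 0 y + b • coordVector e 1 y ≠ 0 := by
      intro h0
      have h1 : mfderiv (𝓡 2) (𝓡 2) e.symm y
          (a • (EuclideanSpace.single 0 (1 : ℝ) : Plane)
            + b • (EuclideanSpace.single 1 (1 : ℝ) : Plane)) = 0 := by
        rw [← h0]
        erw [map_add, map_smul, map_smul]
        rfl
      have h2 : a • (EuclideanSpace.single 0 (1 : ℝ) : Plane)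
          + b • (EuclideanSpace.single 1 (1 : ℝ) : Plane) = 0 := hinj (h1.trans (map_zero _).symm)
      have ha := congrArg (fun v : Plane => v 0) h2
      have hb := congrArg (fun v : Plane => v 1) h2
      have ha' : a = 0 := by simpa using ha
      have hb' : b = 0 := by simpa using hb
      tauto
    have h := g.pos _ _ hv
    have hs := metricMatrix_symm g e y 1 0
    simp only [map_add, map_smul, add_apply, smul_apply,
      smul_eq_mul] at h
    simp only [metricMatrix, Matrix.of_apply] at hs ⊢
    rw [hs] at h
    linarith
  have h0 := key 1 0 (by simp)
  -- The vector `(-g₀₁, g₀₀)` is orthogonal to `∂₀`; its squared length is `g₀₀ · det`.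
  have h1 := key (-metricMatrix g e y 0 1) (metricMatrix g e y 0 0) (by right; simpa using h0.ne')
  rw [Matrix.det_fin_two, metricMatrix_symm g e y 1 0]
  intro h
  have : metricMatrix g e y 0 0 * (metricMatrix g e y 0 0 * metricMatrix g e y 1 1 -
    metricMatrix g e y 0 1 * metricMatrix g e y 0 1) > 0 := by nlinarith
  rw [h] at this
  simp at this

/-- Two charts give base points that are only propositionally equal. All tangent spaces being
`Plane` by definition, the vectors themselves need no transport. -/
theorem inner_congr (g : Metric M) {p q : M} (h : p = q) (v w : Plane) :
    g.inner p (v : TangentSpace (𝓡 2) p) (w : TangentSpace (𝓡 2) p)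
      = g.inner q (v : TangentSpace (𝓡 2) q) (w : TangentSpace (𝓡 2) q) := by
  subst h; rfl

end ManifoldSide

/-! ### Partial derivatives of functions and of matrix-valued functions -/

section Calculus

open Topology Filter Matrix

section PartialDerivatives

variable {f g : Plane → ℝ} {y : Plane}

theorem pd_congr (i : Fin 2) (h : f =ᶠ[𝓝 y] g) : pd i f y = pd i g y := by
  rw [pd, pd, h.fderiv_eq]

theorem pd_add (i : Fin 2) (hf : ContDiffAt ℝ ∞ f y) (hg : ContDiffAt ℝ ∞ g y) :
    pd i (fun z => f z + g z) y = pd i f y + pd i g y := by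
  simp [pd, fderiv_fun_add (hf.differentiableAt (by simp)) (hg.differentiableAt (by simp))]

theorem pd_sub (i : Fin 2) (hf : ContDiffAt ℝ ∞ f y) (hg : ContDiffAt ℝ ∞ g y) :
    pd i (fun z => f z - g z) y = pd i f y - pd i g y := by
  simp [pd, fderiv_fun_sub (hf.differentiableAt (by simp)) (hg.differentiableAt (by simp))]

theorem pd_mul (i : Fin 2) (hf : ContDiffAt ℝ ∞ f y) (hg : ContDiffAt ℝ ∞ g y) :
    pd i (fun z => f z * g z) y = pd i f y * g y + f y * pd i g y := by
  simp [pd, fderiv_fun_mul (hf.differentiableAt (by simp)) (hg.differentiableAt (by simp))]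
  ring

theorem pd_const_mul (i : Fin 2) (a : ℝ) (f : Plane → ℝ) :
    pd i (fun z => a * f z) y = a * pd i f y := by
  change fderiv ℝ (a • f) y _ = _
  rw [fderiv_const_smul_field]
  simp [pd]

theorem pd_const_sub (i : Fin 2) (a : ℝ) (f : Plane → ℝ) :
    pd i (fun z => a - f z) y = -pd i f y := by
  simp [pd, fderiv_const_sub]

theorem pd_neg (i : Fin 2) (f : Plane → ℝ) : pd i (fun z => -f z) y = -pd i f y := by
  simpa using pd_const_mul i (-1) f (y := y)

theorem pd_log (i : Fin 2) (hf : ContDiffAt ℝ ∞ f y) (h0 : f y ≠ 0) :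
    pd i (fun z => Real.log (f z)) y = pd i f y / f y := by
  rw [pd, fderiv.log (hf.differentiableAt (by simp)) h0]
  simp [pd]
  ring

theorem pd_inv (i : Fin 2) (hf : ContDiffAt ℝ ∞ f y) (h0 : f y ≠ 0) :
    pd i (fun z => (f z)⁻¹) y = -pd i f y / f y ^ 2 := by
  have h := ((hasDerivAt_inv h0).comp_hasFDerivAt y
    (hf.differentiableAt (by simp)).hasFDerivAt).fderiv
  change fderiv ℝ (Inv.inv ∘ f) y _ = _
  rw [h]
  simp [pd]
  ring

theorem contDiffAt_pd (i : Fin 2) (hf : ContDiffAt ℝ ∞ f y) : ContDiffAt ℝ ∞ (pd i f) y :=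
  (hf.fderiv_right (m := ∞) (by simp)).clm_apply contDiffAt_const

theorem pd_comm (i j : Fin 2) (hf : ContDiffAt ℝ ∞ f y) :
    pd i (pd j f) y = pd j (pd i f) y := by
  have hs : IsSymmSndFDerivAt ℝ f y := hf.isSymmSndFDerivAt (by
    simpa using (WithTop.coe_le_coe.2 (le_top : (2 : ℕ∞) ≤ ⊤)))
  have hd : DifferentiableAt ℝ (fderiv ℝ f) y :=
    (hf.fderiv_right (m := ∞) (by simp)).differentiableAt (by simp)
  have h : ∀ i j : Fin 2, pd i (pd j f) y =
      fderiv ℝ (fderiv ℝ f) y (EuclideanSpace.single i 1) (EuclideanSpace.single j 1) := by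
    intro i j
    change fderiv ℝ (fun z => fderiv ℝ f z (EuclideanSpace.single j 1)) y _ = _
    rw [fderiv_clm_apply hd (differentiableAt_const _)]
    simp
  rw [h, h]
  exact hs _ _

theorem contDiffAt_coord {φ : Plane → Plane} (hφ : ContDiffAt ℝ ∞ φ y) (a : Fin 2) :
    ContDiffAt ℝ ∞ (fun z => φ z a) y :=
  (EuclideanSpace.proj a : Plane →L[ℝ] ℝ).contDiff.contDiffAt.comp y hφ

theorem plane_eq_sum (v : Plane) : v = ∑ a, v a • (EuclideanSpace.single a (1 : ℝ) : Plane) := by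
  ext b
  fin_cases b <;> simp

theorem pd_coord {φ : Plane → Plane} (hφ : DifferentiableAt ℝ φ y) (i a : Fin 2) :
    pd i (fun z => φ z a) y = fderiv ℝ φ y (EuclideanSpace.single i 1) a := by
  have := ((EuclideanSpace.proj a : Plane →L[ℝ] ℝ).hasFDerivAt.comp y
    hφ.hasFDerivAt).fderiv
  change fderiv ℝ ((EuclideanSpace.proj a : Plane →L[ℝ] ℝ) ∘ φ) y _ = _
  rw [this]
  simp

theorem pd_comp {φ : Plane → Plane} (hf : DifferentiableAt ℝ f (φ y))
    (hφ : DifferentiableAt ℝ φ y) (i : Fin 2) :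
    pd i (fun z => f (φ z)) y = ∑ a, pd i (fun z => φ z a) y * pd a f (φ y) := by
  have h := (hf.hasFDerivAt.comp y hφ.hasFDerivAt).fderiv
  change fderiv ℝ (f ∘ φ) y _ = _
  rw [h, ContinuousLinearMap.comp_apply, plane_eq_sum (fderiv ℝ φ y _), map_sum]
  simp only [pd_coord hφ, map_smul, smul_eq_mul]
  rfl

end PartialDerivatives

/-- The matrix of the partial derivatives `∂ᵢ` of the entries of a matrix-valued function. -/
def pdMat (i : Fin 2) (F : Plane → Matrix (Fin 2) (Fin 2) ℝ) (y : Plane) :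
    Matrix (Fin 2) (Fin 2) ℝ :=
  of fun a b => pd i (fun z => F z a b) y

/-- Smoothness of the entries of a matrix-valued function at a point. -/
def SmoothMatAt (F : Plane → Matrix (Fin 2) (Fin 2) ℝ) (y : Plane) : Prop :=
  ∀ a b, ContDiffAt ℝ ∞ (fun z => F z a b) y

section MatrixCalculus

variable {F H : Plane → Matrix (Fin 2) (Fin 2) ℝ} {y : Plane}

theorem SmoothMatAt.mul (hF : SmoothMatAt F y) (hH : SmoothMatAt H y) :
    SmoothMatAt (fun z => F z * H z) y := fun a b => by
  simp only [Matrix.mul_apply, Fin.sum_univ_two]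
  exact ((hF _ _).mul (hH _ _)).add ((hF _ _).mul (hH _ _))

theorem SmoothMatAt.add (hF : SmoothMatAt F y) (hH : SmoothMatAt H y) :
    SmoothMatAt (fun z => F z + H z) y := fun a b => (hF a b).add (hH a b)

theorem SmoothMatAt.smul {u : Plane → ℝ} (hu : ContDiffAt ℝ ∞ u y) (hF : SmoothMatAt F y) :
    SmoothMatAt (fun z => u z • F z) y := fun a b => hu.mul (hF a b)

theorem SmoothMatAt.transpose (hF : SmoothMatAt F y) : SmoothMatAt (fun z => (F z)ᵀ) y :=
  fun a b => hF b a

theorem SmoothMatAt.pdMat (i : Fin 2) (hF : SmoothMatAt F y) : SmoothMatAt (pdMat i F) y :=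
  fun a b => contDiffAt_pd i (hF a b)

theorem SmoothMatAt.det (hF : SmoothMatAt F y) : ContDiffAt ℝ ∞ (fun z => (F z).det) y := by
  simp only [Matrix.det_fin_two]
  exact ((hF 0 0).mul (hF 1 1)).sub ((hF 0 1).mul (hF 1 0))

theorem SmoothMatAt.eventually_det_ne_zero (hF : SmoothMatAt F y) (h : (F y).det ≠ 0) :
    ∀ᶠ z in 𝓝 y, (F z).det ≠ 0 :=
  hF.det.continuousAt.eventually_ne h

theorem SmoothMatAt.inv (hF : SmoothMatAt F y) (h : (F y).det ≠ 0) :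
    SmoothMatAt (fun z => (F z)⁻¹) y := by
  intro a b
  have hd := hF.det.inv h
  simp only [Matrix.inv_def, Ring.inverse_eq_inv', Matrix.adjugate_fin_two, Matrix.smul_apply,
    smul_eq_mul]
  refine hd.mul ?_
  fin_cases a <;> fin_cases b
  · exact hF 1 1
  · exact (hF 0 1).neg
  · exact (hF 1 0).neg
  · exact hF 0 0

theorem SmoothMatAt.comp {φ : Plane → Plane} (hF : SmoothMatAt F (φ y))
    (hφ : ContDiffAt ℝ ∞ φ y) : SmoothMatAt (fun z => F (φ z)) y :=
  fun a b => (hF a b).comp y hφ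

theorem pdMat_congr (i : Fin 2) (h : F =ᶠ[𝓝 y] H) : pdMat i F y = pdMat i H y := by
  ext a b
  exact pd_congr i (h.mono fun z hz => by simp only [hz])

theorem pdMat_mul (i : Fin 2) (hF : SmoothMatAt F y) (hH : SmoothMatAt H y) :
    pdMat i (fun z => F z * H z) y = pdMat i F y * H y + F y * pdMat i H y := by
  ext a b
  simp only [pdMat, of_apply, Matrix.mul_apply, Fin.sum_univ_two, Matrix.add_apply]
  rw [pd_add i ((hF _ _).mul (hH _ _)) ((hF _ _).mul (hH _ _)), pd_mul i (hF _ _) (hH _ _),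
    pd_mul i (hF _ _) (hH _ _)]
  ring

theorem pdMat_add (i : Fin 2) (hF : SmoothMatAt F y) (hH : SmoothMatAt H y) :
    pdMat i (fun z => F z + H z) y = pdMat i F y + pdMat i H y := by
  ext a b
  exact pd_add i (hF a b) (hH a b)

theorem pdMat_smul (i : Fin 2) {u : Plane → ℝ} (hu : ContDiffAt ℝ ∞ u y) (hF : SmoothMatAt F y) :
    pdMat i (fun z => u z • F z) y = pd i u y • F y + u y • pdMat i F y := by
  ext a b
  exact pd_mul i hu (hF a b)

theorem pdMat_transpose (i : Fin 2) : pdMat i (fun z => (F z)ᵀ) y = (pdMat i F y)ᵀ := rfl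

theorem pdMat_comm (i j : Fin 2) (hF : SmoothMatAt F y) :
    pdMat i (pdMat j F) y = pdMat j (pdMat i F) y := by
  ext a b
  exact pd_comm i j (hF a b)

theorem pdMat_comp {φ : Plane → Plane} (hF : SmoothMatAt F (φ y)) (hφ : ContDiffAt ℝ ∞ φ y)
    (i : Fin 2) :
    pdMat i (fun z => F (φ z)) y = ∑ a, pd i (fun z => φ z a) y • pdMat a F (φ y) := by
  ext b c
  simp only [Matrix.sum_apply]
  exact pd_comp ((hF b c).differentiableAt (by simp)) (hφ.differentiableAt (by simp)) i

end MatrixCalculus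

end Calculus

/-! ### The Levi-Civita connection and its curvature as matrices -/

section LeviCivita

open Topology Filter Matrix

/-- The matrix `(Γˡᵢₖ)ₗₖ` of the Levi-Civita connection in the direction `∂ᵢ`. -/
def conn (G : Plane → Matrix (Fin 2) (Fin 2) ℝ) (i : Fin 2) (y : Plane) :
    Matrix (Fin 2) (Fin 2) ℝ :=
  of fun l k => christoffel G l i k y

/-- The curvature `∂₀A₁ - ∂₁A₀ + A₀A₁ - A₁A₀` of a matrix-valued connection form. -/
def curv (A : Fin 2 → Plane → Matrix (Fin 2) (Fin 2) ℝ) (y : Plane) : Matrix (Fin 2) (Fin 2) ℝ :=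
  pdMat 0 (A 1) y - pdMat 1 (A 0) y + A 0 y * A 1 y - A 1 y * A 0 y

variable {G H : Plane → Matrix (Fin 2) (Fin 2) ℝ} {y : Plane}

theorem coordGauss_eq (G : Plane → Matrix (Fin 2) (Fin 2) ℝ) (y : Plane) :
    coordGauss G y = (G y * curv (conn G) y) 0 1 / (G y).det := by
  simp only [coordGauss, riemann, curv, conn, pdMat, Matrix.mul_apply, Matrix.sub_apply,
    Matrix.add_apply, of_apply, Fin.sum_univ_two]
  ring

theorem curv_congr {A B : Fin 2 → Plane → Matrix (Fin 2) (Fin 2) ℝ}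
    (h : ∀ i, A i =ᶠ[𝓝 y] B i) : curv A y = curv B y := by
  simp only [curv, pdMat_congr _ (h _), (h _).eq_of_nhds]

/-- Lowering the index gives the Christoffel symbols of the first kind, in which the inverse matrix
no longer occurs. -/
theorem mul_conn (hdet : (G y).det ≠ 0) (i : Fin 2) :
    G y * conn G i y = of fun l k => (1 / 2) *
      (pd i (fun z => G z k l) y + pd k (fun z => G z i l) y - pd l (fun z => G z i k) y) := by
  have : conn G i y = (G y)⁻¹ * of fun l k => (1 / 2) *
      (pd i (fun z => G z k l) y + pd k (fun z => G z i l) y - pd l (fun z => G z i k) y) := by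
    ext l k
    simp only [conn, christoffel, Matrix.mul_apply, of_apply, Fin.sum_univ_two]
    ring
  rw [this, Matrix.mul_nonsing_inv_cancel_left _ _ (isUnit_iff_ne_zero.2 hdet)]

theorem pd_entry_symm (hsym : ∀ z, (G z).IsSymm) (i a b : Fin 2) :
    pd i (fun z => G z a b) y = pd i (fun z => G z b a) y := by
  congr 1
  ext z
  exact (hsym z).apply b a

theorem conn_symm (hsym : ∀ z, (G z).IsSymm) (l i k : Fin 2) :
    conn G i y l k = conn G k y l i := by
  simp only [conn, christoffel, of_apply]
  congr 1
  refine Finset.sum_congr rfl fun m _ => ?_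
  rw [pd_entry_symm hsym m i k]
  ring

/-- Metric compatibility `∇g = 0`, in matrix form. -/
theorem pdMat_eq_conn (hsym : ∀ z, (G z).IsSymm) (hdet : (G y).det ≠ 0) (i : Fin 2) :
    pdMat i G y = G y * conn G i y + (conn G i y)ᵀ * G y := by
  have h : (conn G i y)ᵀ * G y = (G y * conn G i y)ᵀ := by
    rw [Matrix.transpose_mul, (hsym y).eq]
  rw [h, mul_conn hdet]
  ext a b
  simp only [pdMat, of_apply, Matrix.add_apply, Matrix.transpose_apply]
  rw [pd_entry_symm hsym i b a, pd_entry_symm hsym b i a, pd_entry_symm hsym a i b]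
  ring

/-- Uniqueness of the Levi-Civita connection. -/
theorem conn_unique (hsym : ∀ z, (G z).IsSymm) (hdet : (G y).det ≠ 0)
    {C : Fin 2 → Matrix (Fin 2) (Fin 2) ℝ} (hC : ∀ l i k, C i l k = C k l i)
    (hcompat : ∀ i, pdMat i G y = G y * C i + (C i)ᵀ * G y) (i : Fin 2) :
    conn G i y = C i := by
  have hu := isUnit_iff_ne_zero.2 hdet
  have hs : ∀ i, (C i)ᵀ * G y = (G y * C i)ᵀ := fun i => by
    rw [Matrix.transpose_mul, (hsym y).eq]
  -- Koszul's argument: compatibility expresses each `∂ᵢ g` through `G C`, and the symmetry of `C`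
  -- makes all but one term of the Christoffel combination cancel.
  have key : G y * conn G i y = G y * C i := by
    have hg : ∀ l i k, (G y * C i) l k = (G y * C k) l i := by
      intro l i k
      simp only [Matrix.mul_apply, hC _ i k]
    have hp : ∀ i a b, pd i (fun z => G z a b) y = (G y * C i) a b + (G y * C i) b a := by
      intro i a b
      have := congrFun (congrFun (hcompat i) a) b
      rw [hs] at this
      exact this
    rw [mul_conn hdet]
    ext l k
    rw [of_apply, hp, hp, hp, hg k i l, hg i k l, hg l k i]
    ring
  calc conn G i y = (G y)⁻¹ * (G y * conn G i y) := by
        rw [Matrix.nonsing_inv_mul_cancel_left _ _ hu]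
    _ = C i := by rw [key, Matrix.nonsing_inv_mul_cancel_left _ _ hu]

theorem smoothMatAt_conn (hG : SmoothMatAt G y) (hdet : (G y).det ≠ 0) (i : Fin 2) :
    SmoothMatAt (conn G i) y := by
  intro l k
  simp only [conn, of_apply, christoffel, Fin.sum_univ_two]
  have h : ∀ m, ContDiffAt ℝ ∞ (fun z => (G z)⁻¹ l m * (pd i (fun z => G z k m) z +
      pd k (fun z => G z i m) z - pd m (fun z => G z i k) z)) y := fun m =>
    (hG.inv hdet l m).mul (((contDiffAt_pd i (hG k m)).add (contDiffAt_pd k (hG i m))).sub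
      (contDiffAt_pd m (hG i k)))
  exact contDiffAt_const.mul ((h 0).add (h 1))

theorem smoothMatAt_curv {A : Fin 2 → Plane → Matrix (Fin 2) (Fin 2) ℝ}
    (hA : ∀ i, SmoothMatAt (A i) y) : SmoothMatAt (curv A) y := by
  intro a b
  simp only [curv, Matrix.sub_apply, Matrix.add_apply]
  exact ((((hA 1).pdMat 0 a b).sub ((hA 0).pdMat 1 a b)).add (((hA 0).mul (hA 1)) a b)).sub
    (((hA 1).mul (hA 0)) a b)

theorem contDiffAt_coordGauss (hG : SmoothMatAt G y) (hdet : (G y).det ≠ 0) :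
    ContDiffAt ℝ ∞ (coordGauss G) y := by
  have h := (hG.mul (smoothMatAt_curv (smoothMatAt_conn hG hdet)) 0 1).div hG.det hdet
  exact h.congr_of_eventuallyEq (Eventually.of_forall fun z => coordGauss_eq G z)

/-- The curvature of the Levi-Civita connection is skew with respect to the metric. -/
theorem mul_curv_skew (hsym : ∀ z, (G z).IsSymm) (hG : SmoothMatAt G y) (hdet : (G y).det ≠ 0) :
    (G y * curv (conn G) y)ᵀ = -(G y * curv (conn G) y) := by
  have hA := smoothMatAt_conn hG hdet
  have hev : ∀ i, pdMat i G =ᶠ[𝓝 y] fun z => G z * conn G i z + (conn G i z)ᵀ * G z := fun i => by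
    filter_upwards [hG.eventually_det_ne_zero hdet] with z hz using pdMat_eq_conn hsym hz i
  have h2 : ∀ j i, pdMat j (pdMat i G) y = pdMat j G y * conn G i y + G y * pdMat j (conn G i) y
      + ((pdMat j (conn G i) y)ᵀ * G y + (conn G i y)ᵀ * pdMat j G y) := fun j i => by
    rw [pdMat_congr j (hev i), pdMat_add j (hG.mul (hA i)) ((hA i).transpose.mul hG),
      pdMat_mul j hG (hA i), pdMat_mul j (hA i).transpose hG, pdMat_transpose]
  -- Commuting mixed partials of `G`, each expanded by compatibility, is exactly the vanishing of
  -- `Ωᵀ G + G Ω` for the curvature `Ω`.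
  have hc := pdMat_comm 0 1 hG
  rw [h2, h2, pdMat_eq_conn hsym hdet, pdMat_eq_conn hsym hdet] at hc
  rw [Matrix.transpose_mul, (hsym y).eq, eq_neg_iff_add_eq_zero]
  have : ∀ A B P Q g : Matrix (Fin 2) (Fin 2) ℝ,
      (P - Q + A * B - B * A)ᵀ * g + g * (P - Q + A * B - B * A) =
      ((g * A + Aᵀ * g) * B + g * P + (Pᵀ * g + Bᵀ * (g * A + Aᵀ * g))) -
      ((g * B + Bᵀ * g) * A + g * Q + (Qᵀ * g + Aᵀ * (g * B + Bᵀ * g))) := by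
    intro A B P Q g
    simp only [Matrix.transpose_sub, Matrix.transpose_add, Matrix.transpose_mul]
    noncomm_ring
  rw [curv, this, hc, sub_self]

/-! ### Behaviour of connection and curvature under a change of coordinates -/

/-- The Jacobian matrix `(∂ₖ φᵃ)ₐₖ`. -/
def jacobian (φ : Plane → Plane) (y : Plane) : Matrix (Fin 2) (Fin 2) ℝ :=
  of fun a k => pd k (fun z => φ z a) y

theorem smoothMatAt_jacobian {φ : Plane → Plane} (hφ : ContDiffAt ℝ ∞ φ y) :
    SmoothMatAt (jacobian φ) y :=
  fun a k => contDiffAt_pd k (contDiffAt_coord hφ a)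

theorem pdMat_jacobian_symm {φ : Plane → Plane} (hφ : ContDiffAt ℝ ∞ φ y) (a i j : Fin 2) :
    pdMat i (jacobian φ) y a j = pdMat j (jacobian φ) y a i :=
  pd_comm i j (contDiffAt_coord hφ a)

/-- The pullback under `φ` of a connection form. -/
def pullConn (A : Fin 2 → Plane → Matrix (Fin 2) (Fin 2) ℝ) (φ : Plane → Plane) (i : Fin 2)
    (z : Plane) : Matrix (Fin 2) (Fin 2) ℝ :=
  jacobian φ z 0 i • A 0 (φ z) + jacobian φ z 1 i • A 1 (φ z)

/-- The gauge transformation law. Solving it for the connection of `H` gives a candidate that is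
symmetric, because second derivatives of `φ` commute, and compatible with `H = Jᵀ G J` by the
product rule; uniqueness identifies it. -/
theorem conn_pullback {φ : Plane → Plane} (hsym : ∀ z, (G z).IsSymm)
    (hsymH : ∀ z, (H z).IsSymm) (hG : SmoothMatAt G (φ y)) (hdet : (G (φ y)).det ≠ 0)
    (hdetH : (H y).det ≠ 0) (hφ : ContDiffAt ℝ ∞ φ y)
    (hH : H =ᶠ[𝓝 y] fun z => (jacobian φ z)ᵀ * G (φ z) * jacobian φ z) (i : Fin 2) :
    jacobian φ y * conn H i y
      = pdMat i (jacobian φ) y + pullConn (conn G) φ i y * jacobian φ y := by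
  have hJ := smoothMatAt_jacobian hφ
  have hdetJ : (jacobian φ y).det ≠ 0 := fun h => hdetH (by simp [hH.eq_of_nhds, h])
  have hu := isUnit_iff_ne_zero.2 hdetJ
  set J := jacobian φ y with hJdef
  let C : Fin 2 → Matrix (Fin 2) (Fin 2) ℝ := fun i =>
    J⁻¹ * (pdMat i (jacobian φ) y + pullConn (conn G) φ i y * J)
  have hJC : ∀ i, J * C i = pdMat i (jacobian φ) y + pullConn (conn G) φ i y * J := fun i =>
    Matrix.mul_nonsing_inv_cancel_left _ _ hu
  have hC : ∀ i, conn H i y = C i := by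
    apply conn_unique hsymH hdetH
    · intro l i k
      have h : ∀ a, (pdMat i (jacobian φ) y + pullConn (conn G) φ i y * J) a k
          = (pdMat k (jacobian φ) y + pullConn (conn G) φ k y * J) a i := by
        intro a
        simp only [Matrix.add_apply, pdMat_jacobian_symm hφ a i k, pullConn, Matrix.mul_apply,
          Fin.sum_univ_two, Matrix.smul_apply, smul_eq_mul, ← hJdef]
        rw [conn_symm hsym a 1 0]
        ring
      simp only [C, Matrix.mul_apply, h]
    · intro i
      have hGφ := hG.comp hφ
      have hpG : pdMat i (fun z => G (φ z)) y =
          G (φ y) * pullConn (conn G) φ i y + (pullConn (conn G) φ i y)ᵀ * G (φ y) := by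
        rw [pdMat_comp hG hφ, Fin.sum_univ_two, pdMat_eq_conn hsym hdet, pdMat_eq_conn hsym hdet]
        simp only [pullConn, Matrix.transpose_add, Matrix.transpose_smul, Matrix.mul_add,
          Matrix.add_mul, Matrix.mul_smul, Matrix.smul_mul, smul_add]
        simp only [jacobian, of_apply]
        abel
      rw [pdMat_congr i hH, pdMat_mul i (hJ.transpose.mul hGφ) hJ, pdMat_mul i hJ.transpose hGφ,
        pdMat_transpose, hpG, hH.eq_of_nhds, ← hJdef]
      have e1 : Jᵀ * G (φ y) * J * C i = Jᵀ * G (φ y) * (J * C i) := by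
        simp only [Matrix.mul_assoc]
      have e2 : (C i)ᵀ * (Jᵀ * G (φ y) * J) = (J * C i)ᵀ * (G (φ y) * J) := by
        simp only [Matrix.mul_assoc, Matrix.transpose_mul]
      rw [e1, e2, hJC]
      simp only [Matrix.transpose_add, Matrix.transpose_mul]
      noncomm_ring
  rw [hC, hJC]

/-- Curvature is a matrix-valued 2-form, so in dimension two its pullback picks up the factor `det
J`. Second derivatives of `φ` drop out by symmetry. -/
theorem curv_pullConn {φ : Plane → Plane} {A : Fin 2 → Plane → Matrix (Fin 2) (Fin 2) ℝ}
    (hφ : ContDiffAt ℝ ∞ φ y) (hA : ∀ i, SmoothMatAt (A i) (φ y)) :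
    curv (pullConn A φ) y = (jacobian φ y).det • curv A (φ y) := by
  have hJ := smoothMatAt_jacobian hφ
  have hp : ∀ i j, pdMat i (pullConn A φ j) y =
      pdMat i (jacobian φ) y 0 j • A 0 (φ y) + jacobian φ y 0 j •
        (jacobian φ y 0 i • pdMat 0 (A 0) (φ y) + jacobian φ y 1 i • pdMat 1 (A 0) (φ y))
      + (pdMat i (jacobian φ) y 1 j • A 1 (φ y) + jacobian φ y 1 j •
        (jacobian φ y 0 i • pdMat 0 (A 1) (φ y) + jacobian φ y 1 i • pdMat 1 (A 1) (φ y))) := by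
    intro i j
    have h : ∀ a, SmoothMatAt (fun z => A a (φ z)) y := fun a => (hA a).comp hφ
    have := pdMat_add i ((h 0).smul (hJ 0 j)) ((h 1).smul (hJ 1 j))
    rw [pdMat_smul i (hJ 0 j) (h 0), pdMat_smul i (hJ 1 j) (h 1), pdMat_comp (hA 0) hφ,
      pdMat_comp (hA 1) hφ, Fin.sum_univ_two, Fin.sum_univ_two] at this
    exact this
  rw [curv, hp, hp, pdMat_jacobian_symm hφ 0 0 1, pdMat_jacobian_symm hφ 1 0 1,
    Matrix.det_fin_two, curv]
  simp only [pullConn]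
  ext a b
  simp only [Matrix.add_apply, Matrix.sub_apply, Matrix.smul_apply, smul_eq_mul, Matrix.mul_apply,
    Fin.sum_univ_two]
  ring

/-- The Gaussian curvature does not depend on the coordinates. -/
theorem coordGauss_pullback {φ : Plane → Plane} (hsym : ∀ z, (G z).IsSymm)
    (hsymH : ∀ z, (H z).IsSymm) (hG : ∀ᶠ z in 𝓝 (φ y), SmoothMatAt G z)
    (hdet : (G (φ y)).det ≠ 0)
    (hsH : SmoothMatAt H y) (hdetH : (H y).det ≠ 0) (hφ : ∀ᶠ z in 𝓝 y, ContDiffAt ℝ ∞ φ z)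
    (hH : H =ᶠ[𝓝 y] fun z => (jacobian φ z)ᵀ * G (φ z) * jacobian φ z) :
    coordGauss H y = coordGauss G (φ y) := by
  have hφy := hφ.self_of_nhds
  have hGy := hG.self_of_nhds
  have hJ := smoothMatAt_jacobian hφy
  have hA := smoothMatAt_conn hGy hdet
  have hA' := smoothMatAt_conn hsH hdetH
  have hcont := hφy.continuousAt
  have hev : ∀ i, (fun z => jacobian φ z * conn H i z) =ᶠ[𝓝 y]
      fun z => pdMat i (jacobian φ) z + pullConn (conn G) φ i z * jacobian φ z := by
    intro i
    filter_upwards [hcont.eventually hG, hcont.eventually (hGy.eventually_det_ne_zero hdet),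
      hsH.eventually_det_ne_zero hdetH, hφ, hH.eventuallyEq_nhds] with z h1 h2 h3 h4 h5
    exact conn_pullback hsym hsymH h1 h2 h3 h4 h5 i
  have hB : ∀ i, SmoothMatAt (pullConn (conn G) φ i) y := fun i =>
    (((hA 0).comp hφy).smul (hJ 0 i)).add (((hA 1).comp hφy).smul (hJ 1 i))
  have hd : ∀ i j, pdMat i (jacobian φ) y * conn H j y + jacobian φ y * pdMat i (conn H j) y =
      pdMat i (pdMat j (jacobian φ)) y + (pdMat i (pullConn (conn G) φ j) y * jacobian φ y
        + pullConn (conn G) φ j y * pdMat i (jacobian φ) y) := by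
    intro i j
    rw [← pdMat_mul i hJ (hA' j), pdMat_congr i (hev j),
      pdMat_add i (hJ.pdMat j) ((hB j).mul hJ), pdMat_mul i (hB j) hJ]
  -- Differentiate the gauge law and antisymmetrise: second derivatives of `J` cancel, and first
  -- derivatives are eliminated by the law itself.
  have hconj : jacobian φ y * curv (conn H) y
      = curv (pullConn (conn G) φ) y * jacobian φ y := by
    have h01 := hd 0 1
    have h10 := hd 1 0
    rw [pdMat_comm 0 1 hJ] at h01
    have e : ∀ i, pdMat i (jacobian φ) y = jacobian φ y * conn H i y
        - pullConn (conn G) φ i y * jacobian φ y := fun i => by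
      rw [(hev i).eq_of_nhds]; abel
    have h := congrArg₂ (· - ·) h01 h10
    simp only [e] at h
    rw [← sub_eq_zero] at h ⊢
    rw [← h, curv, curv]
    noncomm_ring
  rw [curv_pullConn hφy hA] at hconj
  have hskew := mul_curv_skew hsym hGy hdet
  have hdetJ : (jacobian φ y).det ≠ 0 := fun h => hdetH (by simp [hH.eq_of_nhds, h])
  rw [coordGauss_eq, coordGauss_eq, hH.eq_of_nhds, Matrix.mul_assoc, Matrix.mul_assoc, hconj]
  have e : (jacobian φ y)ᵀ * (G (φ y) * ((jacobian φ y).det • curv (conn G) (φ y)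
      * jacobian φ y)) = (jacobian φ y).det • ((jacobian φ y)ᵀ * (G (φ y) * curv (conn G) (φ y))
      * jacobian φ y) := by
    simp only [Matrix.mul_smul, Matrix.smul_mul, Matrix.mul_assoc]
  rw [e]
  -- For skew `S`, `Jᵀ S J = det J · S`. With the factor `det J` from the 2-form, the numerator
  -- scales by `(det J)²`, just as `det (Jᵀ G J)` does.
  generalize G (φ y) * curv (conn G) (φ y) = S at hskew ⊢
  have h00 := congrFun (congrFun hskew 0) 0
  have h11 := congrFun (congrFun hskew 1) 1
  have h10 := congrFun (congrFun hskew 0) 1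
  simp only [Matrix.transpose_apply, Matrix.neg_apply] at h00 h11 h10
  have h00 : S 0 0 = 0 := by linarith
  have h11 : S 1 1 = 0 := by linarith
  have hnum : ((jacobian φ y)ᵀ * S * jacobian φ y) 0 1 = (jacobian φ y).det * S 0 1 := by
    simp only [Matrix.mul_apply, Fin.sum_univ_two, Matrix.transpose_apply, h00, h11, h10,
      Matrix.det_fin_two]
    ring
  rw [Matrix.smul_apply, hnum, Matrix.det_mul, Matrix.det_mul, Matrix.det_transpose, smul_eq_mul]
  field_simp

end LeviCivita

/-! ### Conformal change of metric in coordinates -/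

section Conformal

open Topology Filter Matrix

variable {G : Plane → Matrix (Fin 2) (Fin 2) ℝ} {y : Plane}

/-- The gradient of a function on the coordinate plane. -/
def coordGrad (G : Plane → Matrix (Fin 2) (Fin 2) ℝ) (w : Plane → ℝ) (k : Fin 2) (y : Plane) : ℝ :=
  ∑ l, (G y)⁻¹ k l * pd l w y

theorem contDiffAt_coordGrad {w : Plane → ℝ} (hG : SmoothMatAt G y) (hdet : (G y).det ≠ 0)
    (hw : ContDiffAt ℝ ∞ w y) (k : Fin 2) : ContDiffAt ℝ ∞ (coordGrad G w k) y := by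
  unfold coordGrad
  simp only [Fin.sum_univ_two]
  exact ((hG.inv hdet k 0).mul (contDiffAt_pd 0 hw)).add
    ((hG.inv hdet k 1).mul (contDiffAt_pd 1 hw))

/-- Replacing `∂w` by `G` times the gradient lets later computations expand second derivatives of
`w` without differentiating the inverse matrix. -/
theorem sum_mul_coordGrad {w : Plane → ℝ} (hdet : (G y).det ≠ 0) (i : Fin 2) :
    pd i w y = G y i 0 * coordGrad G w 0 y + G y i 1 * coordGrad G w 1 y := by
  have h := congrFun (Matrix.mulVec_mulVec (fun l => pd l w y) (G y) (G y)⁻¹) i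
  rw [Matrix.mul_nonsing_inv _ (isUnit_iff_ne_zero.2 hdet), Matrix.one_mulVec] at h
  rw [← h]
  simp [Matrix.mulVec, dotProduct, Fin.sum_univ_two, coordGrad]

theorem sum_inv_mul (hdet : (G y).det ≠ 0) (j : Fin 2) (x : Fin 2 → ℝ) :
    ∑ i, (G y)⁻¹ j i * (G y i 0 * x 0 + G y i 1 * x 1) = x j := by
  have h := congrFun (Matrix.mulVec_mulVec x (G y)⁻¹ (G y)) j
  rw [Matrix.nonsing_inv_mul _ (isUnit_iff_ne_zero.2 hdet), Matrix.one_mulVec] at h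
  rw [← h]
  simp [Matrix.mulVec, dotProduct, Fin.sum_univ_two]

/-- The difference of the Levi-Civita connections of `exp (2 w) g` and of `g`. -/
def confDiff (G : Plane → Matrix (Fin 2) (Fin 2) ℝ) (w : Plane → ℝ) (i : Fin 2) (y : Plane) :
    Matrix (Fin 2) (Fin 2) ℝ :=
  of fun k j => (1 : Matrix (Fin 2) (Fin 2) ℝ) k i * pd j w y
    + (1 : Matrix (Fin 2) (Fin 2) ℝ) k j * pd i w y - G y i j * coordGrad G w k y

theorem smoothMatAt_confDiff {w : Plane → ℝ} (hG : SmoothMatAt G y) (hdet : (G y).det ≠ 0)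
    (hw : ContDiffAt ℝ ∞ w y) (i : Fin 2) : SmoothMatAt (confDiff G w i) y := fun k j =>
  ((contDiffAt_const.mul (contDiffAt_pd j hw)).add
    (contDiffAt_const.mul (contDiffAt_pd i hw))).sub
    ((hG i j).mul (contDiffAt_coordGrad hG hdet hw k))

theorem isSymm_smul (hsym : ∀ z, (G z).IsSymm) (u : Plane → ℝ) (z : Plane) :
    (u z • G z).IsSymm := (hsym z).smul _

/-- The hypothesis `huw` says `du = 2u dw`, i.e. `w` is `½ log |u|` up to a local constant. The
correction term is symmetric, and its compatibility defect `2 ∂ᵢw · G` absorbs the derivative of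
`u`, so uniqueness applies. -/
theorem conn_smul {u w : Plane → ℝ} (hsym : ∀ z, (G z).IsSymm) (hG : SmoothMatAt G y)
    (hdet : (G y).det ≠ 0) (hu : ContDiffAt ℝ ∞ u y) (hu0 : u y ≠ 0)
    (huw : ∀ i, pd i u y = 2 * u y * pd i w y) (i : Fin 2) :
    conn (fun z => u z • G z) i y = conn G i y + confDiff G w i y := by
  have hs : ∀ i j, G y i j = G y j i := fun i j => (hsym y).apply j i
  refine conn_unique (C := fun i => conn G i y + confDiff G w i y) (isSymm_smul hsym u) ?_ ?_ ?_ i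
  · simp [hu0, hdet]
  · intro l i k
    simp only [Matrix.add_apply, confDiff, of_apply, hs i k]
    rw [conn_symm hsym l i k]
    ring
  · intro i
    rw [pdMat_smul i hu hG, pdMat_eq_conn hsym hdet, huw]
    have key : G y * confDiff G w i y + (confDiff G w i y)ᵀ * G y = (2 * pd i w y) • G y := by
      ext a b
      have h0 := sum_mul_coordGrad (w := w) hdet 0
      have h1 := sum_mul_coordGrad (w := w) hdet 1
      have h10 := hs 1 0
      revert i a b
      simp only [Fin.forall_fin_two]
      refine ⟨⟨⟨?_, ?_⟩, ?_, ?_⟩, ⟨?_, ?_⟩, ?_, ?_⟩ <;>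
      · simp [confDiff, Matrix.mul_apply, Fin.sum_univ_two, h0, h1, h10]
        ring
    simp only [Matrix.transpose_add, Matrix.smul_mul, Matrix.mul_smul, Matrix.mul_add,
      Matrix.add_mul, smul_add]
    have key2 : u y • (G y * confDiff G w i y) + u y • ((confDiff G w i y)ᵀ * G y)
        = (2 * u y * pd i w y) • G y := by
      rw [← smul_add, key, smul_smul]; congr 1; ring
    rw [← key2]
    abel

/-- Since `∇g = 0`, the Hessian of `w` is the covariant derivative of its gradient with an index
lowered; contracting with the inverse metric leaves a divergence. -/
theorem coordLaplacian_eq_neg_div {w : Plane → ℝ} (hsym : ∀ z, (G z).IsSymm)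
    (hG : SmoothMatAt G y) (hdet : (G y).det ≠ 0) (hw : ContDiffAt ℝ ∞ w y) :
    coordLaplacian G w y = -∑ k, (pd k (coordGrad G w k) y
      + ∑ j, conn G k y k j * coordGrad G w j y) := by
  have hV := contDiffAt_coordGrad hG hdet hw
  have hs : G y 1 0 = G y 0 1 := (hsym y).apply 0 1
  have hpp : ∀ i j, pd i (pd j w) y = pd i (fun z => G z j 0) y * coordGrad G w 0 y
      + G y j 0 * pd i (coordGrad G w 0) y + (pd i (fun z => G z j 1) y * coordGrad G w 1 y
      + G y j 1 * pd i (coordGrad G w 1) y) := by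
    intro i j
    have : pd j w =ᶠ[𝓝 y]
        fun z => G z j 0 * coordGrad G w 0 z + G z j 1 * coordGrad G w 1 z := by
      filter_upwards [hG.eventually_det_ne_zero hdet] with z hz using sum_mul_coordGrad hz j
    rw [pd_congr i this, pd_add i ((hG j 0).mul (hV 0)) ((hG j 1).mul (hV 1)),
      pd_mul i (hG j 0) (hV 0), pd_mul i (hG j 1) (hV 1)]
  have hc : ∀ i a b, pd i (fun z => G z a b) y = G y a 0 * conn G i y 0 b
      + G y a 1 * conn G i y 1 b + (conn G i y 0 a * G y 0 b + conn G i y 1 a * G y 1 b) := by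
    intro i a b
    have := congrFun (congrFun (pdMat_eq_conn hsym hdet i) a) b
    simpa [pdMat, Matrix.mul_apply, Fin.sum_univ_two] using this
  have hess : ∀ i j, pd i (pd j w) y - ∑ k, christoffel G k i j y * pd k w y
      = G y j 0 * (pd i (coordGrad G w 0) y + ∑ m, conn G i y 0 m * coordGrad G w m y)
      + G y j 1 * (pd i (coordGrad G w 1) y + ∑ m, conn G i y 1 m * coordGrad G w m y) := by
    intro i j
    have hch : ∀ k, christoffel G k i j y = conn G i y k j := fun k => rfl
    rw [hpp, Fin.sum_univ_two, hch, hch, hc, hc, sum_mul_coordGrad hdet 0,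
      sum_mul_coordGrad hdet 1, Fin.sum_univ_two, Fin.sum_univ_two, hs]
    ring
  have hinv : ∀ i, ∑ j, (G y)⁻¹ i j * (pd i (pd j w) y - ∑ k, christoffel G k i j y * pd k w y)
      = pd i (coordGrad G w i) y + ∑ m, conn G i y i m * coordGrad G w m y := by
    intro i
    simp only [hess]
    exact sum_inv_mul hdet i fun k =>
      pd i (coordGrad G w k) y + ∑ m, conn G i y k m * coordGrad G w m y
  simp only [coordLaplacian, hinv]

/-- In dimension two the terms quadratic in `dw` cancel from the curvature component, leaving only
`det G` times the Laplacian of `w`. -/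
theorem coordGauss_smul_exp {u w : Plane → ℝ} (hsym : ∀ z, (G z).IsSymm)
    (hG : ∀ᶠ z in 𝓝 y, SmoothMatAt G z) (hdet : (G y).det ≠ 0)
    (hu : ∀ᶠ z in 𝓝 y, ContDiffAt ℝ ∞ u z) (hu0 : u y ≠ 0) (hw : ContDiffAt ℝ ∞ w y)
    (huw : ∀ᶠ z in 𝓝 y, ∀ i, pd i u z = 2 * u z * pd i w z) :
    coordGauss (fun z => u z • G z) y = (coordGauss G y + coordLaplacian G w y) / u y := by
  have hGy := hG.self_of_nhds
  have hA := smoothMatAt_conn hGy hdet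
  have hT := smoothMatAt_confDiff hGy hdet hw
  have hV := contDiffAt_coordGrad hGy hdet hw
  have hW := fun i => contDiffAt_pd i hw
  have hs : G y 1 0 = G y 0 1 := (hsym y).apply 0 1
  have hcs : ∀ l, conn G 1 y l 0 = conn G 0 y l 1 := fun l => conn_symm hsym l 1 0
  have hcurv : curv (conn fun z => u z • G z) y
      = curv (fun i z => conn G i z + confDiff G w i z) y := by
    apply curv_congr
    intro i
    filter_upwards [hG, hGy.eventually_det_ne_zero hdet, hu,
      hu.self_of_nhds.continuousAt.eventually_ne hu0, huw] with z h1 h2 h3 h4 h5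
    exact conn_smul hsym h1 h2 h3 h4 h5 i
  have hc : ∀ i a b, pd i (fun z => G z a b) y = G y a 0 * conn G i y 0 b
      + G y a 1 * conn G i y 1 b + (conn G i y 0 a * G y 0 b + conn G i y 1 a * G y 1 b) := by
    intro i a b
    have := congrFun (congrFun (pdMat_eq_conn hsym hdet i) a) b
    simpa [pdMat, Matrix.mul_apply, Fin.sum_univ_two] using this
  have hpp : ∀ i j, pd i (pd j w) y = pd i (fun z => G z j 0) y * coordGrad G w 0 y
      + G y j 0 * pd i (coordGrad G w 0) y + (pd i (fun z => G z j 1) y * coordGrad G w 1 y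
      + G y j 1 * pd i (coordGrad G w 1) y) := by
    intro i j
    have : pd j w =ᶠ[𝓝 y]
        fun z => G z j 0 * coordGrad G w 0 z + G z j 1 * coordGrad G w 1 z := by
      filter_upwards [hGy.eventually_det_ne_zero hdet] with z hz using sum_mul_coordGrad hz j
    rw [pd_congr i this, pd_add i ((hGy j 0).mul (hV 0)) ((hGy j 1).mul (hV 1)),
      pd_mul i (hGy j 0) (hV 0), pd_mul i (hGy j 1) (hV 1)]
  have hpT : ∀ m i k j, pdMat m (confDiff G w i) y k j =
      (1 : Matrix (Fin 2) (Fin 2) ℝ) k i * pd m (pd j w) y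
      + (1 : Matrix (Fin 2) (Fin 2) ℝ) k j * pd m (pd i w) y
      - (pd m (fun z => G z i j) y * coordGrad G w k y
        + G y i j * pd m (coordGrad G w k) y) := by
    intro m i k j
    simp only [pdMat, confDiff, of_apply]
    rw [pd_sub m ((contDiffAt_const.mul (hW j)).add (contDiffAt_const.mul (hW i)))
      ((hGy i j).mul (hV k)), pd_add m (contDiffAt_const.mul (hW j))
      (contDiffAt_const.mul (hW i)), pd_const_mul, pd_const_mul, pd_mul m (hGy i j) (hV k)]
  have hsymm := pd_comm 0 1 hw
  have hnum : (G y * curv (fun i z => conn G i z + confDiff G w i z) y) 0 1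
      = (G y * curv (conn G) y) 0 1 + (G y).det * coordLaplacian G w y := by
    rw [coordLaplacian_eq_neg_div hsym hGy hdet hw, curv, curv, pdMat_add 0 (hA 1) (hT 1),
      pdMat_add 1 (hA 0) (hT 0), Matrix.det_fin_two]
    have h0 := sum_mul_coordGrad (w := w) hdet 0
    have h1 := sum_mul_coordGrad (w := w) hdet 1
    -- Written through the gradient, commutation of the mixed partials of `w` is no longer
    -- automatic; it is the one relation that the final identity needs.
    rw [hpp, hpp, hc, hc, hc, hc, hs, hcs, hcs] at hsymm
    simp only [Matrix.mul_apply, Matrix.add_apply, Matrix.sub_apply, Fin.sum_univ_two, hpT]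
    simp only [confDiff, of_apply, Matrix.one_apply_eq, Matrix.one_apply_ne (zero_ne_one' (Fin 2)),
      Matrix.one_apply_ne (one_ne_zero' (Fin 2)), hpp, h0, h1, hc, hs, hcs]
    linear_combination (G y 0 1) * hsymm
  -- The numerator carries one factor `u` and the determinant `u²`, hence the quotient by `u`.
  rw [coordGauss_eq, coordGauss_eq, hcurv, Matrix.smul_mul, Matrix.smul_apply, hnum,
    Matrix.det_smul, smul_eq_mul]
  simp only [Fintype.card_fin]
  field_simp

theorem coordLaplacian_const_mul (a : ℝ) (f : Plane → ℝ) :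
    coordLaplacian G (fun z => a * f z) y = a * coordLaplacian G f y := by
  have h : ∀ j, pd j (fun z => a * f z) = fun z => a * pd j f z :=
    fun j => funext fun z => pd_const_mul j a f
  simp only [coordLaplacian, h, pd_const_mul, Fin.sum_univ_two]
  ring

/-- The Gaussian curvature of a metric conformal to `G`. -/
theorem coordGauss_smul {u : Plane → ℝ} (hsym : ∀ z, (G z).IsSymm)
    (hG : ∀ᶠ z in 𝓝 y, SmoothMatAt G z) (hdet : (G y).det ≠ 0)
    (hu : ∀ᶠ z in 𝓝 y, ContDiffAt ℝ ∞ u z) (hu0 : 0 < u y) :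
    coordGauss (fun z => u z • G z) y
      = (coordGauss G y + 1 / 2 * coordLaplacian G (fun z => Real.log (u z)) y) / u y := by
  -- Absorbing the factor `½` exhibits the potential `w = ½ log u`.
  rw [← coordLaplacian_const_mul]
  have huy := hu.self_of_nhds
  refine coordGauss_smul_exp hsym hG hdet hu hu0.ne'
    (contDiffAt_const.mul (huy.log hu0.ne')) ?_
  filter_upwards [hu, huy.continuousAt.eventually_ne hu0.ne'] with z h1 h2 i
  rw [pd_const_mul, pd_log i h1 h2]
  field_simp

theorem coordLaplacian_log_const_sub {f : Plane → ℝ} {c : ℝ}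
    (hf : ∀ᶠ z in 𝓝 y, ContDiffAt ℝ ∞ f z) (h0 : c - f y ≠ 0) :
    coordLaplacian G (fun z => Real.log (c - f z)) y
      = -coordLaplacian G f y / (c - f y) + coordGradNormSq G f y / (c - f y) ^ 2 := by
  have hfy := hf.self_of_nhds
  have hcf : ContDiffAt ℝ ∞ (fun z => c - f z) y := contDiffAt_const.sub hfy
  have h1 : ∀ j, pd j (fun z => Real.log (c - f z)) =ᶠ[𝓝 y]
      fun z => -pd j f z * (c - f z)⁻¹ := by
    intro j
    filter_upwards [hf, hcf.continuousAt.eventually_ne h0] with z hz hz0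
    rw [pd_log j (contDiffAt_const.sub hz) hz0, pd_const_sub]
    rfl
  have hinv : ∀ i, pd i (fun z => (c - f z)⁻¹) y = pd i f y / (c - f y) ^ 2 := by
    intro i
    rw [pd_inv i hcf h0, pd_const_sub, neg_neg]
  have h2 : ∀ i j, pd i (pd j fun z => Real.log (c - f z)) y
      = -pd i (pd j f) y / (c - f y) - pd j f y * pd i f y / (c - f y) ^ 2 := by
    intro i j
    rw [pd_congr i (h1 j),
      pd_mul (g := fun z => (c - f z)⁻¹) i (contDiffAt_pd j hfy).neg (hcf.inv h0), hinv, pd_neg]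
    ring
  have h1' := fun j => (h1 j).eq_of_nhds
  simp only [coordLaplacian, coordGradNormSq, h2, h1', Fin.sum_univ_two]
  field_simp
  ring

end Conformal

/-! ### Passage from coordinates to the surface -/

section Surface

theorem contMDiff_rpow {M : Type*} [TopologicalSpace M] [ChartedSpace Plane M] {f : M → ℝ}
    (hf : ContMDiff (𝓡 2) 𝓘(ℝ) ∞ f) (hpos : ∀ p, 0 < f p) (a : ℝ) :
    ContMDiff (𝓡 2) 𝓘(ℝ) ∞ fun p => f p ^ a := fun p =>
  (Real.contDiffAt_rpow_const_of_ne (hpos p).ne').contMDiffAt.comp p (hf p)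

variable {M : Type*} [TopologicalSpace M] [ChartedSpace Plane M] [IsManifold (𝓡 2) ∞ M]
open Topology Filter Bundle
open scoped Matrix

theorem contDiffAt_transition {e e' : OpenPartialHomeomorph M Plane} (he : e ∈ atlas Plane M)
    (he' : e' ∈ atlas Plane M) {y : Plane} (hy : y ∈ e'.target) (hy' : e'.symm y ∈ e.source) :
    ContDiffAt ℝ ∞ (e ∘ e'.symm) y := by
  have h1 : ContMDiffAt (𝓡 2) (𝓡 2) ∞ e'.symm y :=
    contMDiffAt_symm_of_mem_maximalAtlas (IsManifold.subset_maximalAtlas he') hy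
  have h2 : ContMDiffAt (𝓡 2) (𝓡 2) ∞ e (e'.symm y) :=
    contMDiffAt_of_mem_maximalAtlas (IsManifold.subset_maximalAtlas he) hy'
  exact (h2.comp y h1).contDiffAt

/-- The chain rule for `e'.symm = e.symm ∘ (e ∘ e'.symm)`, which holds only near `y`. -/
theorem coordVector_transition {e e' : OpenPartialHomeomorph M Plane} (he : e ∈ atlas Plane M)
    (he' : e' ∈ atlas Plane M) {y : Plane} (hy : y ∈ e'.target) (hy' : e'.symm y ∈ e.source)
    (i : Fin 2) :
    (coordVector e' i y : Plane) = ∑ a, jacobian (e ∘ e'.symm) y a i •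
      (coordVector e a ((e ∘ e'.symm) y) : Plane) := by
  have hφ := (contDiffAt_transition he he' hy hy').differentiableAt (by simp)
  have hm : MDifferentiableAt (𝓡 2) (𝓡 2) e.symm ((e ∘ e'.symm) y) :=
    (mdifferentiable_of_mem_atlas (I := 𝓡 2) he).mdifferentiableAt_symm (e.map_source hy')
  have h1 := hm.hasMFDerivAt.comp y hφ.hasFDerivAt.hasMFDerivAt
  have hev : e'.symm =ᶠ[𝓝 y] e.symm ∘ (e ∘ e'.symm) := by
    filter_upwards [(e'.continuousAt_symm hy).preimage_mem_nhds (e.open_source.mem_nhds hy')]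
      with z hz
    exact (e.left_inv hz).symm
  have h2 := (h1.congr_of_eventuallyEq hev).mfderiv
  have h3 : (coordVector e' i y : Plane) = mfderiv (𝓡 2) (𝓡 2) e.symm ((e ∘ e'.symm) y)
      (fderiv ℝ (e ∘ e'.symm) y (EuclideanSpace.single i 1)) := by
    rw [coordVector, h2]
    rfl
  rw [h3, plane_eq_sum (fderiv ℝ (e ∘ e'.symm) y (EuclideanSpace.single i 1))]
  erw [map_sum]
  refine Finset.sum_congr rfl fun a _ => ?_
  erw [map_smul]
  simp only [jacobian, Matrix.of_apply, pd_coord hφ]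
  rfl

theorem metricMatrix_transition (g : Metric M) {e e' : OpenPartialHomeomorph M Plane}
    (he : e ∈ atlas Plane M) (he' : e' ∈ atlas Plane M) {y : Plane} (hy : y ∈ e'.target)
    (hy' : e'.symm y ∈ e.source) :
    metricMatrix g e' y = (jacobian (e ∘ e'.symm) y)ᵀ * metricMatrix g e ((e ∘ e'.symm) y)
      * jacobian (e ∘ e'.symm) y := by
  ext i j
  have hp : e'.symm y = e.symm ((e ∘ e'.symm) y) := (e.left_inv hy').symm
  have h := (inner_congr g hp (coordVector e' i y) (coordVector e' j y)).trans
    (congrArg₂ (fun v w : Plane => g.inner (e.symm ((e ∘ e'.symm) y)) v w)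
      (coordVector_transition he he' hy hy' i) (coordVector_transition he he' hy hy' j))
  have hexp : ∀ (p : M) (a b c d : ℝ) (v w : TangentSpace (𝓡 2) p),
      g.inner p (a • v + b • w) (c • v + d • w) = a * (c * g.inner p v v) + a * (d * g.inner p v w)
        + (b * (c * g.inner p w v) + b * (d * g.inner p w w)) := by
    intro p a b c d v w
    simp only [map_add, map_smul, add_apply, smul_apply, smul_eq_mul]
    ring
  rw [Fin.sum_univ_two, Fin.sum_univ_two] at h
  refine (h.trans (hexp _ _ _ _ _ _ _)).trans ?_
  simp only [Matrix.mul_apply, Fin.sum_univ_two, Matrix.transpose_apply, metricMatrix, Matrix.of_apply]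
  ring

theorem isSymm_metricMatrix (g : Metric M) (e : OpenPartialHomeomorph M Plane) (z : Plane) :
    (metricMatrix g e z).IsSymm :=
  Matrix.IsSymm.ext fun i j => metricMatrix_symm g e z j i

/-- The Gaussian curvature can be computed in any chart of the atlas. -/
theorem gaussCurvature_eq (g : Metric M) {e : OpenPartialHomeomorph M Plane}
    (he : e ∈ atlas Plane M) {p : M} (hp : p ∈ e.source) :
    gaussCurvature g p = coordGauss (metricMatrix g e) (e p) := by
  set e' := chartAt Plane p
  have he' : e' ∈ atlas Plane M := chart_mem_atlas Plane p
  have hp' : p ∈ e'.source := mem_chart_source Plane p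
  have hy : e' p ∈ e'.target := e'.map_source hp'
  have hinv : e'.symm (e' p) = p := e'.left_inv hp'
  have hval : (e ∘ e'.symm) (e' p) = e p := congrArg e hinv
  have hmem : ∀ᶠ z in 𝓝 (e' p), z ∈ e'.target ∧ e'.symm z ∈ e.source := by
    refine (e'.open_target.eventually_mem hy).and ?_
    exact (e'.continuousAt_symm hy).preimage_mem_nhds
      (e.open_source.mem_nhds (by rwa [hinv]))
  have h := coordGauss_pullback (G := metricMatrix g e) (H := metricMatrix g e') (y := e' p)
    (φ := e ∘ e'.symm) (isSymm_metricMatrix g e) (isSymm_metricMatrix g e') ?_ ?_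
    (contDiffAt_metricMatrix g he' hy) (metricMatrix_det_ne_zero g he' hy) ?_ ?_
  · rw [hval] at h
    exact h
  · rw [hval]
    filter_upwards [e.open_target.mem_nhds (e.map_source hp)] with z hz
      using contDiffAt_metricMatrix g he hz
  · rw [hval]
    exact metricMatrix_det_ne_zero g he (e.map_source hp)
  · filter_upwards [hmem] with z hz using contDiffAt_transition he he' hz.1 hz.2
  · filter_upwards [hmem] with z hz using metricMatrix_transition g he he' hz.1 hz.2

/-- The preferred chart jumps as the point moves; chart independence replaces it by the fixed chart
`e`, where the coordinate formula is visibly smooth. -/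
theorem contDiffAt_gaussCurvature_comp_symm (g : Metric M) {e : OpenPartialHomeomorph M Plane}
    (he : e ∈ atlas Plane M) {y : Plane} (hy : y ∈ e.target) :
    ContDiffAt ℝ ∞ (gaussCurvature g ∘ e.symm) y := by
  refine (contDiffAt_coordGauss (contDiffAt_metricMatrix g he hy)
    (metricMatrix_det_ne_zero g he hy)).congr_of_eventuallyEq ?_
  filter_upwards [e.open_target.mem_nhds hy] with z hz
  rw [Function.comp, gaussCurvature_eq g he (e.map_target hz), e.right_inv hz]

theorem contMDiff_gaussCurvature (g : Metric M) :
    ContMDiff (𝓡 2) 𝓘(ℝ) ∞ (gaussCurvature g) := by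
  intro p
  have hp := mem_chart_source Plane p
  have he := chart_mem_atlas Plane p
  have h1 := (contDiffAt_gaussCurvature_comp_symm g he ((chartAt Plane p).map_source hp)).contMDiffAt
  have h2 : ContMDiffAt (𝓡 2) (𝓡 2) ∞ (chartAt Plane p) p :=
    contMDiffAt_of_mem_maximalAtlas (IsManifold.subset_maximalAtlas he) hp
  refine (h1.comp p h2).congr_of_eventuallyEq ?_
  filter_upwards [(chartAt Plane p).open_source.mem_nhds hp] with q hq
  simp only [Function.comp, (chartAt Plane p).left_inv hq]

/-- The metric `u g` for a positive smooth function `u`. -/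
def scaledMetric (g : Metric M) (u : M → ℝ) (hu : ContMDiff (𝓡 2) 𝓘(ℝ) ∞ u)
    (hpos : ∀ p, 0 < u p) : Metric M where
  inner p := u p • g.inner p
  symm p v w := by
    simp only [smul_apply, g.symm p v w]
  pos p v hv := by
    simp only [smul_apply, smul_eq_mul]
    exact mul_pos (hpos p) (g.pos p v hv)
  isVonNBounded p := by
    -- The unit ball of `u g` lies in the image of the unit ball of `g` under scaling by `u^(-1/2)`.
    have h := (g.isVonNBounded p).image
      ((Real.sqrt (u p))⁻¹ • ContinuousLinearMap.id ℝ (TangentSpace (𝓡 2) p))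
    refine h.subset ?_
    intro v hv
    have hs : 0 < Real.sqrt (u p) := Real.sqrt_pos.2 (hpos p)
    refine ⟨Real.sqrt (u p) • v, ?_, ?_⟩
    · have hv' : u p * g.inner p v v < 1 := hv
      simp only [Set.mem_ofPred_eq, map_smul, smul_apply, smul_eq_mul, ← mul_assoc,
        Real.mul_self_sqrt (hpos p).le]
      exact hv'
    · simp [smul_smul, hs.ne']
  contMDiff := ContMDiff.smul_section (F := Plane →L[ℝ] Plane →L[ℝ] ℝ)
    (V := fun p : M => TangentSpace (𝓡 2) p →L[ℝ] TangentSpace (𝓡 2) p →L[ℝ] ℝ) hu g.contMDiff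

theorem isScaling_scaledMetric (g : Metric M) (u : M → ℝ) (hu : ContMDiff (𝓡 2) 𝓘(ℝ) ∞ u)
    (hpos : ∀ p, 0 < u p) : IsScaling (scaledMetric g u hu hpos) g u :=
  fun _ _ _ => rfl

theorem contDiffAt_comp_symm {u : M → ℝ} (hu : ContMDiff (𝓡 2) 𝓘(ℝ) ∞ u)
    {e : OpenPartialHomeomorph M Plane} (he : e ∈ atlas Plane M) {y : Plane}
    (hy : y ∈ e.target) : ContDiffAt ℝ ∞ (u ∘ e.symm) y := by
  have h1 : ContMDiffAt (𝓡 2) (𝓡 2) ∞ e.symm y :=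
    contMDiffAt_symm_of_mem_maximalAtlas (IsManifold.subset_maximalAtlas he) hy
  exact (hu.contMDiffAt.comp y h1).contDiffAt

/-- The Gaussian curvature of a metric conformal to `g`. -/
theorem gaussCurvature_of_isScaling {g h : Metric M} {u : M → ℝ}
    (hu : ContMDiff (𝓡 2) 𝓘(ℝ) ∞ u) (hpos : ∀ p, 0 < u p) (hs : IsScaling h g u) (p : M) :
    gaussCurvature h p
      = (gaussCurvature g p + 1 / 2 * laplacian g (fun q => Real.log (u q)) p) / u p := by
  set e := chartAt Plane p with hedef
  have he : e ∈ atlas Plane M := chart_mem_atlas Plane p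
  have hp : p ∈ e.source := mem_chart_source Plane p
  have hy := e.map_source hp
  have hm : metricMatrix h e = fun z => (u ∘ e.symm) z • metricMatrix g e z := by
    funext z
    ext i j
    exact hs _ _ _
  have hev : ∀ᶠ z in 𝓝 (e p), z ∈ e.target := e.open_target.mem_nhds hy
  have key := coordGauss_smul (G := metricMatrix g e) (u := u ∘ e.symm) (y := e p)
    (isSymm_metricMatrix g e) (hev.mono fun z hz => contDiffAt_metricMatrix g he hz)
    (metricMatrix_det_ne_zero g he hy) (hev.mono fun z hz => contDiffAt_comp_symm hu he hz)
    (hpos _)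
  rw [gaussCurvature, ← hedef, hm, key]
  simp only [Function.comp, e.left_inv hp]
  rfl

theorem laplacian_log_const_sub {g : Metric M} {f : M → ℝ} (hf : ContMDiff (𝓡 2) 𝓘(ℝ) ∞ f) {c : ℝ}
    {p : M} (h0 : c - f p ≠ 0) :
    laplacian g (fun q => Real.log (c - f q)) p
      = -laplacian g f p / (c - f p) + gradNormSq g f p / (c - f p) ^ 2 := by
  have he := chart_mem_atlas Plane p
  have hp := mem_chart_source Plane p
  have hinv := (chartAt Plane p).left_inv hp
  have key := coordLaplacian_log_const_sub (G := metricMatrix g (chartAt Plane p))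
    (f := f ∘ (chartAt Plane p).symm) (c := c) (y := chartAt Plane p p)
    (((chartAt Plane p).open_target.eventually_mem ((chartAt Plane p).map_source hp)).mono
      fun z hz => contDiffAt_comp_symm hf he hz) (by simpa only [Function.comp, hinv] using h0)
  simp only [Function.comp, hinv] at key
  exact key

theorem laplacian_const_mul (g : Metric M) (a : ℝ) (f : M → ℝ) (p : M) :
    laplacian g (fun q => a * f q) p = a * laplacian g f p :=
  coordLaplacian_const_mul a _

end Surface

/-! ### The equivalences -/

section Equivalences

variable {M : Type*} [TopologicalSpace M] [ChartedSpace Plane M] [IsManifold (𝓡 2) ∞ M]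

theorem curvature_equation_iff_log (g : Metric M) {c : ℝ} (hK : ∀ p, 0 < c - gaussCurvature g p) :
    (∀ p, (c - gaussCurvature g p) * laplacian g (gaussCurvature g) p
        - gradNormSq g (gaussCurvature g) p
        - (8 / 3) * gaussCurvature g p * (c - gaussCurvature g p) ^ 2 = 0) ↔
      ∀ p, laplacian g (fun q => Real.log (c - gaussCurvature g q)) p
        + (8 / 3) * gaussCurvature g p = 0 := by
  refine forall_congr' fun p => ?_
  have h := (hK p).ne'
  rw [laplacian_log_const_sub (contMDiff_gaussCurvature g) h]
  generalize c - gaussCurvature g p = f at h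
  -- Equation (ii) is (i) divided by `-(c - K)²`.
  have e : -laplacian g (gaussCurvature g) p / f + gradNormSq g (gaussCurvature g) p / f ^ 2
      + (8 / 3) * gaussCurvature g p = -(f * laplacian g (gaussCurvature g) p
        - gradNormSq g (gaussCurvature g) p - (8 / 3) * gaussCurvature g p * f ^ 2) / f ^ 2 := by
    field_simp
    ring
  rw [e, div_eq_zero_iff, neg_eq_zero]
  simp [h]

/-- The curvature formula holds for every metric satisfying the scaling relation, so the existential
costs nothing: one direction applies it to the given `h`, the other to `scaledMetric`. -/
theorem exists_scaling_iff (g : Metric M) {u : M → ℝ} (hu : ContMDiff (𝓡 2) 𝓘(ℝ) ∞ u)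
    (hpos : ∀ p, 0 < u p) (k : ℝ) :
    (∃ h : Metric M, IsScaling h g u ∧ HasConstantCurvature h k) ↔
      ∀ p, gaussCurvature g p + 1 / 2 * laplacian g (fun q => Real.log (u q)) p = k * u p := by
  constructor
  · rintro ⟨h, hs, hc⟩ p
    have := gaussCurvature_of_isScaling hu hpos hs p
    rw [hc p, eq_div_iff (hpos p).ne'] at this
    exact this.symm
  · intro hp
    refine ⟨scaledMetric g u hu hpos, isScaling_scaledMetric g u hu hpos, fun p => ?_⟩
    rw [gaussCurvature_of_isScaling hu hpos (isScaling_scaledMetric g u hu hpos), hp,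
      mul_div_cancel_right₀ _ (hpos p).ne']

theorem log_iff_exists_flat (g : Metric M) {c : ℝ} (hK : ∀ p, 0 < c - gaussCurvature g p) :
    (∀ p, laplacian g (fun q => Real.log (c - gaussCurvature g q)) p
        + (8 / 3) * gaussCurvature g p = 0) ↔
      ∃ h : Metric M, IsScaling h g (fun p => (c - gaussCurvature g p) ^ (3 / 4 : ℝ)) ∧
        IsFlat h := by
  have hf : ContMDiff (𝓡 2) 𝓘(ℝ) ∞ fun p => c - gaussCurvature g p :=
    contMDiff_const.sub (contMDiff_gaussCurvature g)
  refine Iff.trans ?_ (exists_scaling_iff g (contMDiff_rpow hf hK _)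
    (fun p => Real.rpow_pos_of_pos (hK p) _) 0).symm
  refine forall_congr' fun p => ?_
  have : (fun q => Real.log ((c - gaussCurvature g q) ^ (3 / 4 : ℝ)))
      = fun q => (3 / 4) * Real.log (c - gaussCurvature g q) :=
    funext fun q => Real.log_rpow (hK q) _
  rw [this, laplacian_const_mul]
  -- The exponent `3/4` leaves `K + (3/8) Δ log (c - K) = 0`; multiply by `8/3`.
  constructor <;> intro h <;> linarith

theorem log_iff_exists_constant_curvature (g : Metric M)
    (hK : ∀ p, 0 < 0 - gaussCurvature g p) :
    (∀ p, laplacian g (fun q => Real.log (0 - gaussCurvature g q)) p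
        + (8 / 3) * gaussCurvature g p = 0) ↔
      ∃ h : Metric M, IsScaling h g (fun p => -gaussCurvature g p) ∧
        HasConstantCurvature h (1 / 3) := by
  simp only [zero_sub] at hK ⊢
  refine Iff.trans ?_ (exists_scaling_iff g (contMDiff_gaussCurvature g).neg hK (1 / 3)).symm
  refine forall_congr' fun p => ?_
  -- Here `K + ½ Δ log (-K) = -K/3`; moving `K/3` across and doubling gives the coefficient `8/3`.
  constructor <;> intro h <;> linarith

end Equivalences

end RiemSurface

end

theorem propositionp {M : Type*} [TopologicalSpace M] [ChartedSpace RiemSurface.Plane M]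
    [IsManifold (𝓡 2) ∞ M] (g : RiemSurface.Metric M) (c : ℝ)
    (hK : ∀ p : M, 0 < c - RiemSurface.gaussCurvature g p) :
    List.TFAE [
      ∀ p : M, (c - RiemSurface.gaussCurvature g p) *
            RiemSurface.laplacian g (RiemSurface.gaussCurvature g) p
          - RiemSurface.gradNormSq g (RiemSurface.gaussCurvature g) p
          - (8 / 3) * RiemSurface.gaussCurvature g p *
            (c - RiemSurface.gaussCurvature g p) ^ 2 = 0,
      ∀ p : M, RiemSurface.laplacian g (fun q => Real.log (c - RiemSurface.gaussCurvature g q)) p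
          + (8 / 3) * RiemSurface.gaussCurvature g p = 0,
      ∃ h : RiemSurface.Metric M,
        RiemSurface.IsScaling h g
          (fun p => (c - RiemSurface.gaussCurvature g p) ^ (3 / 4 : ℝ)) ∧
        RiemSurface.IsFlat h]
    ∧ (c = 0 →
      List.TFAE [
        ∀ p : M, (c - RiemSurface.gaussCurvature g p) *
              RiemSurface.laplacian g (RiemSurface.gaussCurvature g) p
            - RiemSurface.gradNormSq g (RiemSurface.gaussCurvature g) p
            - (8 / 3) * RiemSurface.gaussCurvature g p *
              (c - RiemSurface.gaussCurvature g p) ^ 2 = 0,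
        ∀ p : M, RiemSurface.laplacian g
              (fun q => Real.log (c - RiemSurface.gaussCurvature g q)) p
            + (8 / 3) * RiemSurface.gaussCurvature g p = 0,
        ∃ h : RiemSurface.Metric M,
          RiemSurface.IsScaling h g
            (fun p => (c - RiemSurface.gaussCurvature g p) ^ (3 / 4 : ℝ)) ∧
          RiemSurface.IsFlat h,
        ∃ h : RiemSurface.Metric M,
          RiemSurface.IsScaling h g (fun p => -RiemSurface.gaussCurvature g p) ∧
          RiemSurface.HasConstantCurvature h (1 / 3)]) := by
  have h12 := RiemSurface.curvature_equation_iff_log g hK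
  have h23 := RiemSurface.log_iff_exists_flat g hK
  refine ⟨?_, ?_⟩
  · tfae_have 1 ↔ 2 := h12
    tfae_have 2 ↔ 3 := h23
    tfae_finish
  · rintro rfl
    have h24 := RiemSurface.log_iff_exists_constant_curvature g hK
    tfae_have 1 ↔ 2 := h12
    tfae_have 2 ↔ 3 := h23
    tfae_have 2 ↔ 4 := h24
    tfae_finish
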